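/- Let $m\ge 0$ and $n\ge 1$ be integers, let $A\in\mathbb{Z}^{m\times n}$ have rows $a_1^\top,\dots,a_m^\top$, let $b\in\mathbb{Z}^m$ and $\alpha\in\mathbb{Z}^n$, put $P:=\{x\in\mathbb{R}^n : Ax\le b\}$, and assume that $P\cap\mathbb{Z}^n=\{0\}$. For $I\subseteq\{1,\dots,m\}$ let $A_I$ be the submatrix of the rows of $A$ indexed by $I$, let $P_I:=P\cap\ker A_I$ (so $P_\emptyset=P$), let $\gcd A_I$ be the greatest common divisor of the absolute values of the $r\times r$ minors of $A_I$, where $r=\operatorname{rank}A_I$ (so $\gcd A_\emptyset=1$), and, for $|I|\le n-1$, let $$\Delta_I:=\frac{1}{\gcd A_I}\cdot\max\left\{\left|\det\begin{pmatrix}\alpha^\top\\ A_K\end{pmatrix}\right| : I\subseteq K\subseteq\{1,\dots,m\},\ |K|=n-1\right\}.$$ For $I$ with $|I|\le n-1$ indexing linearly independent rows of $A$, let $\kappa_I$ be the number with $\max_{x\in P_I}\alpha^\top x=\kappa_I\,\Delta_I$, where $\kappa_I:=0$ if $\Delta_I=0$ (in which case the maximum is $0$). For an integer $e\ge 1$ let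 $$\kappa_e:=\max\{\kappa_I : I\subseteq\{1,\dots,m\},\ |I|\le n-1,\ \text{the rows of } A_I \text{ are linearly independent},\ \dim P_I=e\}.$$ **Theorem.** Let $I\subseteq\{1,\dots,m\}$ index linearly independent rows of $A$ such that $\ker A_I$ is the linear span of $P$. Let $d:=\dim P=\sum_{i=0}^k d_i$, where $k\ge 0$ and $d_0,\dots,d_k$ are positive integers. Then $\max_{x\in P}\alpha^\top x$ exists and $$\max_{x\in P}\ \alpha^\top x\ \le\ \Delta_I\cdot\sum_{i=0}^k\kappa_{d_i}.$$ -/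

import Mathlib

open scoped Matrix

noncomputable section

namespace Proximity

/-- The rows of `A` indexed by `I`, as a real matrix `A_I`. -/
def rowsOf {m n : ℕ} (A : Matrix (Fin m) (Fin n) ℤ) (I : Finset (Fin m)) :
    Matrix I (Fin n) ℝ :=
  Matrix.of fun i j => (A i j : ℝ)

/-- The kernel of `A_I` in `ℝⁿ` (the whole space if `I` is empty). -/
def kerRows {m n : ℕ} (A : Matrix (Fin m) (Fin n) ℤ) (I : Finset (Fin m)) :
    Submodule ℝ (Fin n → ℝ) :=
  LinearMap.ker (rowsOf A I).mulVecLin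

/-- The rows of `A` indexed by `I` are linearly independent. -/
def IndepRows {m n : ℕ} (A : Matrix (Fin m) (Fin n) ℤ) (I : Finset (Fin m)) : Prop :=
  LinearIndependent ℝ (rowsOf A I).row

/-- The polyhedron `P = P(A, b) = {x ∈ ℝⁿ : A x ≤ b}`. -/
def poly {m n : ℕ} (A : Matrix (Fin m) (Fin n) ℤ) (b : Fin m → ℤ) : Set (Fin n → ℝ) :=
  {x | ∀ i, (fun j => (A i j : ℝ)) ⬝ᵥ x ≤ (b i : ℝ)}

/-- The slice `P_I = P ∩ ker A_I`. -/
def polySlice {m n : ℕ} (A : Matrix (Fin m) (Fin n) ℤ) (b : Fin m → ℤ)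
    (I : Finset (Fin m)) : Set (Fin n → ℝ) :=
  poly A b ∩ kerRows A I

/-- The (affine) dimension of a subset of `ℝⁿ`. -/
def dim {n : ℕ} (S : Set (Fin n → ℝ)) : ℕ :=
  Module.finrank ℝ (vectorSpan ℝ S)

/-- The linear form `x ↦ αᵀ x` on `ℝⁿ`. -/
def linForm {n : ℕ} (α : Fin n → ℤ) (x : Fin n → ℝ) : ℝ :=
  (fun j => (α j : ℝ)) ⬝ᵥ x

/-- `gcd A_I`: the gcd of the absolute values of the `r × r` minors of `A_I`, `r = rank A_I`.
A submatrix is given by an injective choice of rows and of columns; the order in which they are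
listed does not affect the absolute value of the determinant. For `I = ∅` this is `1`. -/
def gcdRows {m n : ℕ} (A : Matrix (Fin m) (Fin n) ℤ) (I : Finset (Fin m)) : ℕ :=
  (Finset.univ : Finset ((Fin (rowsOf A I).rank ↪ I) × (Fin (rowsOf A I).rank ↪ Fin n))).gcd
    fun p => (A.submatrix (fun i => (p.1 i : Fin m)) p.2).det.natAbs

open Classical in
/-- In ambient dimension `n + 1`: the maximum of `|det (α ; A_K)|` over the sets `K` of `n` row
indices with `I ⊆ K`. The set `K` is listed by an injection `f : Fin n ↪ Fin m` with range `K`;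
the order of the list does not affect the absolute value. -/
def maxDet {m n : ℕ} (A : Matrix (Fin m) (Fin (n + 1)) ℤ) (α : Fin (n + 1) → ℤ)
    (I : Finset (Fin m)) : ℕ :=
  ((Finset.univ : Finset (Fin n ↪ Fin m)).filter fun f : Fin n ↪ Fin m => ∀ i ∈ I, i ∈ Set.range f).sup
    fun f => (Matrix.of (Matrix.vecCons α fun j => A (f j))).det.natAbs

/-- `Δ_I(A, α) = (1 / gcd A_I) · max {|det (α ; A_K)| : I ⊆ K, |K| = n}`
in ambient dimension `n + 1`. -/
def Delta {m n : ℕ} (A : Matrix (Fin m) (Fin (n + 1)) ℤ) (α : Fin (n + 1) → ℤ)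
    (I : Finset (Fin m)) : ℝ :=
  1 / (gcdRows A I : ℝ) * (maxDet A α I : ℝ)

/-- `κ_I`: the number with `max {αᵀ x : x ∈ P_I} = κ_I · Δ_I`. If `Δ_I = 0` it is `0`: when `P` is
bounded and the rows in `I` are independent, `Δ_I = 0` happens only if `α` vanishes on `ker A_I`,
and then the maximum is `0` as well. -/
def kappaSet {m n : ℕ} (A : Matrix (Fin m) (Fin (n + 1)) ℤ) (b : Fin m → ℤ)
    (α : Fin (n + 1) → ℤ) (I : Finset (Fin m)) : ℝ :=
  sSup (linForm α '' polySlice A b I) / Delta A α I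

/-- `κ_d`: the maximum of `κ_I` over the sets `I` of at most `n` row indices (in ambient dimension
`n + 1`) with `dim P_I = d`. Only independent sets of rows are considered: a dependent set `I` has
`Δ_I = 0`, so that `κ_I` need not exist, and `P_I = P_{I'}` for any basis `I'` of its rows. -/
def kappa {m n : ℕ} (A : Matrix (Fin m) (Fin (n + 1)) ℤ) (b : Fin m → ℤ)
    (α : Fin (n + 1) → ℤ) (d : ℕ) : ℝ :=
  sSup (kappaSet A b α ''
    {I : Finset (Fin m) | I.card ≤ n ∧ IndepRows A I ∧ dim (polySlice A b I) = d})

end Proximity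

end

open Proximity

/-!
Every point `x` of `P` determines a flat `zeroFlat a x` of the arrangement of the hyperplanes
`a i = 0` given by the rows `a i` of `A`: the intersection of the hyperplanes that contain `x`. The
theorem follows from two facts about these flats.

**Splitting.** If the flat of `x` has dimension at most `p + q`, then `x = y + z` where the flats of
`y` and `z` have dimension at most `p` and at most `q`, and `a i y` and `a i z` lie between `0` and
`a i x` (`exists_conformal_split`). With signs chosen so that `a i x ≥ 0`, consider the spindle
`{y | 0 ≤ a i y ≤ a i x}`. At a vertex `y` the flats of `y` and `x - y` meet in `0`, and along an
edge they meet in a line, so that their dimensions add up to at most `p + q + 1`. Among the vertices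
whose flat has dimension at most `p`, take the one where the form `∑ i, a i`, which has its unique
maximum on the spindle at `x`, is largest. Unless it is `x`, it has an edge along which the form
increases, and the flat of the other endpoint has dimension at least `p + 1`; hence the flat of
`x - y` has dimension at most `q`. Since `0 ∈ P`, both summands lie in `P`, and iteration writes a
maximizer of `α` as a sum of points of `P` whose flats have dimensions at most `d i`.

**Growing.** If `y ∈ P`, then `P` spans the flat of `y` within that flat, and the flat is contained
in flats of points of `P` of every dimension from its own to `dim P` (`exists_finrank_zeroFlat_eq`): a small
step from `y / 2` along an extreme ray of the cone of admissible directions, taken modulo the flat,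
raises the dimension by one. So each summand lies in a slice `P_J`, where `J ⊇ I` is independent and
`dim P_J` is exactly `d i`, and there `α` is at most `κ_J Δ_J ≤ κ_{d i} Δ_J`.

Finally `Δ_J ≤ Δ_I`: there are fewer determinants to choose from, and `gcd A_I` divides `gcd A_J` by
Laplace expansion (`gcdRows_dvd_gcdRows`). The maxima exist because `P` is compact: a nontrivial
recession cone of a rational polyhedron contains a nonzero integer vector (`recession_trivial`).
-/

open scoped Matrix

open Proximity Module

namespace Proximity

/-! ### Extreme rays, flats, and conformal splittings -/

section Cones

variable {E : Type*} [AddCommGroup E] [Module ℝ E] {ι : Type*}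

/-- The ratio test of linear programming: slacks `r` that decrease at the rates `s` stay nonnegative
up to a first positive time at which one of the decreasing slacks vanishes. -/
theorem exists_max_step [Finite ι] (r s : ι → ℝ) (hs : ∀ j, 0 < s j → 0 < r j)
    (hr : ∀ j, 0 ≤ r j) (hex : ∃ j, 0 < s j) :
    ∃ t > 0, (∀ j, t * s j ≤ r j) ∧ ∃ j, 0 < s j ∧ t * s j = r j := by
  obtain ⟨j, hj, hmin⟩ := Set.exists_min_image {j | 0 < s j} (fun j => r j / s j)
    (Set.toFinite _) hex
  have hj' : 0 < s j := hj
  refine ⟨r j / s j, div_pos (hs j hj) hj, fun i => ?_, j, hj, div_mul_cancel₀ _ hj'.ne'⟩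
  rcases lt_or_ge 0 (s i) with hi | hi
  · exact (le_div_iff₀ hi).1 (hmin i hi)
  · exact (mul_nonpos_of_nonneg_of_nonpos (div_pos (hs j hj) hj).le hi).trans (hr i)

/-- A cone `{v | ∀ i, 0 ≤ f i v}` containing a point where `c` is positive has an extreme ray
(modulo its lineality space) on which `c` is positive. -/
theorem exists_extreme_ray [Finite ι] (f : ι → Dual ℝ E) (c : Dual ℝ E) (v₀ : E)
    (h₀ : ∀ i, 0 ≤ f i v₀) (hc : 0 < c v₀) :
    ∃ v, (∀ i, 0 ≤ f i v) ∧ 0 < c v ∧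
      ∀ u, (∀ i, f i v = 0 → f i u = 0) → ∃ t : ℝ, ∀ i, f i u = t * f i v := by
  -- A point of the cone with `c > 0` and as few nonzero coordinates `f i v` as possible will do.
  induction hN : {i | f i v₀ ≠ 0}.ncard using Nat.strong_induction_on generalizing v₀ with
  | _ N ih =>
    by_cases hv : ∀ u, (∀ i, f i v₀ = 0 → f i u = 0) → ∃ t : ℝ, ∀ i, f i u = t * f i v₀
    · exact ⟨v₀, h₀, hc, hv⟩
    push Not at hv
    obtain ⟨u, hu, hut⟩ := hv
    -- Moving within the hyperplanes `c = const` preserves the positivity of `c`.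
    obtain ⟨w, hw, hcw, i, hi⟩ : ∃ w, (∀ i, f i v₀ = 0 → f i w = 0) ∧ c w = 0 ∧
        ∃ i, f i w < 0 := by
      have h1 : ∀ i, f i v₀ = 0 → f i (u - (c u / c v₀) • v₀) = 0 := fun i hi => by
        simp [hi, hu i hi]
      have h2 : c (u - (c u / c v₀) • v₀) = 0 := by
        simp [div_mul_cancel₀ _ hc.ne']
      obtain ⟨i, hi⟩ := hut (c u / c v₀)
      have h3 : f i (u - (c u / c v₀) • v₀) ≠ 0 := by
        simpa [sub_eq_zero] using hi
      rcases lt_or_gt_of_ne h3 with h | h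
      · exact ⟨_, h1, h2, i, h⟩
      · refine ⟨-(u - (c u / c v₀) • v₀), fun i hi => ?_, ?_, i, ?_⟩
        · rw [map_neg, h1 i hi, neg_zero]
        · rw [map_neg, h2, neg_zero]
        · rw [map_neg]; linarith
    obtain ⟨t, -, ht, j, hj, htj⟩ := exists_max_step (fun i => f i v₀) (fun i => -f i w)
      (fun i hi => (h₀ i).lt_of_ne fun h => by simp [hw i h.symm] at hi) h₀ ⟨i, by simpa using hi⟩
    refine ih _ ?_ (v₀ + t • w) (fun i => ?_) (by simpa [hcw] using hc) rfl
    · rw [← hN]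
      refine Set.ncard_lt_ncard ⟨fun i hi h => hi ?_, fun h => ?_⟩ (Set.toFinite _)
      · simp [h, hw i h]
      · refine h (a := j) (fun h' => ?_) ?_
        · simp [hw j h'] at hj
        · simp only [map_add, map_smul, smul_eq_mul]; linarith
    · have := ht i
      simp only [map_add, map_smul, smul_eq_mul]; linarith

/-- The flat of the arrangement of the hyperplanes `a i = 0` spanned by `x`: the intersection of
all those hyperplanes that contain `x`. -/
def zeroFlat (a : ι → Dual ℝ E) (x : E) : Submodule ℝ E where
  carrier := {v | ∀ i, a i x = 0 → a i v = 0}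
  zero_mem' := by simp
  add_mem' hu hv i hi := by simp [hu i hi, hv i hi]
  smul_mem' t v hv i hi := by simp [hv i hi]

theorem mem_zeroFlat {a : ι → Dual ℝ E} {x v : E} :
    v ∈ zeroFlat a x ↔ ∀ i, a i x = 0 → a i v = 0 := Iff.rfl

theorem self_mem_zeroFlat (a : ι → Dual ℝ E) (x : E) : x ∈ zeroFlat a x := fun _ h => h

theorem zeroFlat_mono {a : ι → Dual ℝ E} {x y : E} (h : ∀ i, a i x = 0 → a i y = 0) :
    zeroFlat a y ≤ zeroFlat a x := fun _ hv i hi => hv i (h i hi)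

theorem zeroFlat_zero {a : ι → Dual ℝ E} (hinj : ∀ v, (∀ i, a i v = 0) → v = 0) :
    zeroFlat a 0 = ⊥ :=
  (Submodule.eq_bot_iff _).2 fun v hv => hinj v fun i => hv i (map_zero _)

variable [FiniteDimensional ℝ E]

/-- The decomposition of `exists_conformal_split` when all `a i x` are nonnegative. The point `y` is
a vertex of the spindle `{y | ∀ i, 0 ≤ a i y ≤ a i x}`. -/
theorem exists_conformal_split_of_nonneg [Fintype ι] (a : ι → Dual ℝ E)
    (hinj : ∀ v, (∀ i, a i v = 0) → v = 0) (x : E) (hx : ∀ i, 0 ≤ a i x) (p q : ℕ)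
    (hpq : finrank ℝ (zeroFlat a x) ≤ p + q) :
    ∃ y, (∀ i, 0 ≤ a i y ∧ a i y ≤ a i x) ∧
      finrank ℝ (zeroFlat a y) ≤ p ∧ finrank ℝ (zeroFlat a (x - y)) ≤ q := by
  set T : Set E := {y | (∀ i, 0 ≤ a i y ∧ a i y ≤ a i x) ∧
    zeroFlat a y ⊓ zeroFlat a (x - y) = ⊥ ∧ finrank ℝ (zeroFlat a y) ≤ p} with hT
  -- A vertex is determined by the set of constraints that are tight at it.
  have hfin : T.Finite := by
    refine Set.Finite.of_injOn (f := fun y => ({i | a i y = 0}, {i | a i (x - y) = 0}))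
      (t := Set.univ) (fun _ _ => trivial) (fun y hy z hz hyz => ?_) (Set.toFinite _)
    simp only [Prod.mk.injEq, Set.ext_iff, Set.mem_ofPred_eq] at hyz
    rw [← sub_eq_zero, ← Submodule.mem_bot ℝ, ← hy.2.1]
    refine ⟨fun i hi => ?_, fun i hi => ?_⟩
    · rw [map_sub, hi, (hyz.1 i).1 hi, sub_zero]
    · have h := (hyz.2 i).1 hi
      rw [map_sub] at *
      linarith
  have h0 : (0 : E) ∈ T := by
    refine ⟨fun i => by simpa using hx i, ?_, ?_⟩ <;> rw [zeroFlat_zero hinj] <;> simp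
  set c : Dual ℝ E := ∑ i, a i with hc
  have hcapp : ∀ v, c v = ∑ i, a i v := fun v => by simp [hc]
  obtain ⟨y, ⟨hy, hyv, hyp⟩, hmax⟩ := Set.exists_max_image T c hfin ⟨0, h0⟩
  refine ⟨y, hy, hyp, ?_⟩
  by_contra! hq
  have hne : y ≠ x := by
    rintro rfl
    rw [sub_self, zeroFlat_zero hinj] at hq
    simp at hq
  have hnn : ∀ i, 0 ≤ a i (x - y) := fun i => by rw [map_sub]; linarith [(hy i).2]
  have hcxy : 0 < c (x - y) := by
    rw [hcapp]
    refine (Finset.sum_nonneg fun i _ => hnn i).lt_of_ne fun h => hne ?_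
    rw [eq_comm, Finset.sum_eq_zero_iff_of_nonneg fun i _ => hnn i] at h
    exact (sub_eq_zero.1 (hinj _ fun i => h i (Finset.mem_univ i))).symm
  -- The direction `v` of an edge of the spindle at `y` along which `c` increases.
  obtain ⟨v, hv, hcv, hvu⟩ := exists_extreme_ray
    (Sum.elim (fun i : {i // a i y = 0} => a i) (fun i : {i // a i (x - y) = 0} => -a i)) c (x - y)
    (by rintro (⟨i, hi⟩ | ⟨i, hi⟩)
        · simpa using hnn i
        · simp only [Sum.elim_inr, LinearMap.neg_apply, hi, neg_zero, le_refl]) hcxy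
  have hv1 : ∀ i, a i y = 0 → 0 ≤ a i v := fun i hi => hv (Sum.inl ⟨i, hi⟩)
  have hv2 : ∀ i, a i (x - y) = 0 → a i v ≤ 0 := fun i hi => by
    simpa using hv (Sum.inr ⟨i, hi⟩)
  have hray : ∀ u, (∀ i, a i y = 0 → a i v = 0 → a i u = 0) →
      (∀ i, a i (x - y) = 0 → a i v = 0 → a i u = 0) → ∃ t : ℝ, u = t • v := by
    intro u h1 h2
    obtain ⟨t, ht⟩ := hvu u (by
      rintro (⟨i, hi⟩ | ⟨i, hi⟩) h
      · exact h1 i hi h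
      · simpa using h2 i hi (by simpa using h))
    refine ⟨t, ?_⟩
    rw [← sub_eq_zero, ← Submodule.mem_bot ℝ, ← hyv]
    refine ⟨fun i hi => ?_, fun i hi => ?_⟩
    · have := ht (Sum.inl ⟨i, hi⟩)
      simp only [Sum.elim_inl] at this
      simp [this]
    · have := ht (Sum.inr ⟨i, hi⟩)
      simp only [Sum.elim_inr, LinearMap.neg_apply] at this
      simp only [map_sub, map_smul, smul_eq_mul]
      linarith
  obtain ⟨t, ht0, ht, j, hj, htj⟩ := exists_max_step
    (Sum.elim (fun i => a i y) (fun i => a i (x - y)))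
    (Sum.elim (fun i => -a i v) (fun i => a i v))
    (by rintro (i | i) h
        · exact (hy i).1.lt_of_ne fun h' => by
            have := hv1 i h'.symm; simp only [Sum.elim_inl] at h; linarith
        · exact (hnn i).lt_of_ne fun h' => by
            have := hv2 i h'.symm; simp only [Sum.elim_inr] at h; linarith)
    (by rintro (i | i)
        · exact (hy i).1
        · exact hnn i)
    (by rw [hcapp] at hcv
        obtain ⟨i, -, hi⟩ := Finset.exists_lt_of_sum_lt (s := Finset.univ) (f := fun _ => (0 : ℝ))
          (g := fun i => a i v) (by simpa using hcv)
        exact ⟨Sum.inr i, hi⟩)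
  -- The other endpoint `z` of the edge is a vertex, so its flat has dimension at least `p + 1`.
  set z := y + t • v with hz
  have haz : ∀ i, a i z = a i y + t * a i v := fun i => by simp [hz]
  have haxz : ∀ i, a i (x - z) = a i (x - y) - t * a i v := fun i => by
    rw [map_sub, map_sub, haz]; ring
  have hzS : ∀ i, 0 ≤ a i z ∧ a i z ≤ a i x := fun i => by
    have h1 := ht (Sum.inl i)
    have h2 := ht (Sum.inr i)
    simp only [Sum.elim_inl, Sum.elim_inr, map_sub] at h1 h2
    rw [haz]
    constructor <;> linarith
  have hzv : zeroFlat a z ⊓ zeroFlat a (x - z) = ⊥ := by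
    refine (Submodule.eq_bot_iff _).2 fun u ⟨hu1, hu2⟩ => ?_
    obtain ⟨r, rfl⟩ := hray u (fun i hi h => hu1 i (by rw [haz, hi, h]; simp))
      (fun i hi h => hu2 i (by rw [haxz, hi, h]; simp))
    suffices r = 0 by simp [this]
    rcases j with j | j
    · simp only [Sum.elim_inl] at hj htj
      have := hu1 j (by rw [haz]; linarith)
      rw [map_smul, smul_eq_mul, mul_eq_zero] at this
      exact this.resolve_right (by linarith)
    · simp only [Sum.elim_inr] at hj htj
      have := hu2 j (by rw [haxz]; linarith)
      rw [map_smul, smul_eq_mul, mul_eq_zero] at this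
      exact this.resolve_right (by linarith)
  have hzp : p < finrank ℝ (zeroFlat a z) := by
    by_contra! h
    have := hmax z ⟨hzS, hzv, h⟩
    rw [hz, map_add, map_smul, smul_eq_mul] at this
    linarith [mul_pos ht0 hcv]
  -- At the midpoint `w` of the edge the two flats meet in the line spanned by `v` only, so that
  -- their dimensions add up to at most `p + q + 1`.
  set w := y + (t / 2) • v with hw
  have haw : ∀ i, a i w = a i y / 2 + a i z / 2 := fun i => by
    rw [haz, hw, map_add, map_smul, smul_eq_mul]; ring
  have haxw : ∀ i, a i (x - w) = a i (x - y) / 2 + a i (x - z) / 2 := fun i => by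
    rw [map_sub, map_sub, map_sub, haw]; ring
  have hnz : ∀ i, 0 ≤ a i (x - z) := fun i => by rw [map_sub]; linarith [(hzS i).2]
  have hw1 : ∀ i, a i w = 0 → a i z = 0 := fun i hi => by
    linarith [haw i, (hy i).1, (hzS i).1]
  have hw2 : ∀ i, a i (x - w) = 0 → a i (x - y) = 0 := fun i hi => by
    linarith [haxw i, hnn i, hnz i]
  have h1 := Submodule.finrank_mono (zeroFlat_mono hw1)
  have h2 := Submodule.finrank_mono (zeroFlat_mono hw2)
  have h3 := Submodule.finrank_sup_add_finrank_inf_eq (zeroFlat a w) (zeroFlat a (x - w))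
  have h4 : finrank ℝ ↥(zeroFlat a w ⊓ zeroFlat a (x - w)) ≤ 1 := by
    have hv0 : v ≠ 0 := fun h => by simp [h] at hcv
    rw [← finrank_span_singleton (K := ℝ) hv0]
    refine Submodule.finrank_mono fun u hu => ?_
    obtain ⟨hu1, hu2⟩ := hu
    obtain ⟨r, rfl⟩ := hray u (fun i hi h => hu1 i (by rw [haw, haz, hi, h]; simp))
      (fun i hi h => hu2 i (by rw [haxw, haxz, hi, h]; simp))
    exact Submodule.mem_span_singleton.2 ⟨r, rfl⟩
  have h5 : finrank ℝ ↥(zeroFlat a w ⊔ zeroFlat a (x - w)) ≤ finrank ℝ (zeroFlat a x) := by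
    refine Submodule.finrank_mono (sup_le (zeroFlat_mono fun i hi => ?_)
      (zeroFlat_mono fun i hi => ?_))
    · linarith [haw i, (hy i).1, (hzS i).1, (hy i).2, (hzS i).2]
    · have h := haxw i
      rw [map_sub _ x y, map_sub _ x z] at h
      linarith [(hy i).1, (hzS i).1, (hy i).2, (hzS i).2]
  omega

/-- A point `x` whose flat has dimension at most `p + q` is a sum of two points `y` and `x - y`
whose flats have dimension at most `p` and at most `q`, without cancellation in any of the values
`a i y + a i (x - y) = a i x`. -/
theorem exists_conformal_split [Fintype ι] (a : ι → Dual ℝ E)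
    (hinj : ∀ v, (∀ i, a i v = 0) → v = 0) (x : E) (p q : ℕ)
    (hpq : finrank ℝ (zeroFlat a x) ≤ p + q) :
    ∃ y, (∀ i, a i y ∈ Set.uIcc 0 (a i x)) ∧
      finrank ℝ (zeroFlat a y) ≤ p ∧ finrank ℝ (zeroFlat a (x - y)) ≤ q := by
  set s : ι → ℝ := fun i => if 0 ≤ a i x then 1 else -1 with hs
  have hs0 : ∀ i, s i ≠ 0 := fun i => by simp only [hs]; split_ifs <;> norm_num
  have hflat : ∀ y, zeroFlat (fun i => s i • a i) y = zeroFlat a y := fun y => by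
    ext v
    simp [mem_zeroFlat, hs0]
  obtain ⟨y, hy, hyp, hyq⟩ := exists_conformal_split_of_nonneg (fun i => s i • a i)
    (fun v hv => hinj v fun i => by simpa [hs0] using hv i) x
    (fun i => by
      simp only [hs, LinearMap.smul_apply, smul_eq_mul]
      split_ifs <;> linarith) p q (by rwa [hflat])
  rw [hflat] at hyp hyq
  refine ⟨y, fun i => ?_, hyp, hyq⟩
  have := hy i
  simp only [hs, LinearMap.smul_apply, smul_eq_mul] at this
  rw [Set.mem_uIcc]
  split_ifs at this
  · left; constructor <;> linarith
  · right; constructor <;> linarith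

/-- A function that is bounded in terms of the dimension of the flat of a point of the polyhedron
`{x | ∀ i, a i x ≤ b i}` is bounded along every splitting of that dimension. -/
theorem le_sum_of_finrank_zeroFlat_le [Fintype ι] (a : ι → Dual ℝ E)
    (hinj : ∀ v, (∀ i, a i v = 0) → v = 0) (b : ι → ℝ) (hb : ∀ i, 0 ≤ b i) (φ : Dual ℝ E)
    (F : ℕ → ℝ) (k : ℕ) (d : Fin k → ℕ)
    (hF : ∀ j, ∀ y, (∀ i, a i y ≤ b i) → finrank ℝ (zeroFlat a y) ≤ d j → φ y ≤ F (d j))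
    (x : E) (hx : ∀ i, a i x ≤ b i) (hd : finrank ℝ (zeroFlat a x) ≤ ∑ j, d j) :
    φ x ≤ ∑ j, F (d j) := by
  induction k generalizing x with
  | zero =>
    have h : zeroFlat a x = ⊥ := Submodule.finrank_eq_zero.1 (by simpa using hd)
    have hx0 : x = 0 := (Submodule.mem_bot ℝ).1 (h ▸ self_mem_zeroFlat a x)
    simp [hx0]
  | succ k ih =>
    rw [Fin.sum_univ_succ] at hd ⊢
    obtain ⟨y, hy, hy1, hy2⟩ := exists_conformal_split a hinj x _ _ hd
    have h1 := hF 0 y (fun i => (hy i).2.trans (max_le (hb i) (hx i))) hy1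
    have h2 := ih (fun j => d j.succ) (fun j => hF j.succ) (x - y)
      (fun i => by
        rw [map_sub]
        rcases Set.mem_uIcc.1 (hy i) with h | h
        · linarith [hx i]
        · linarith [hb i]) hy2
    rw [map_sub] at h2
    linarith

end Cones

/-! ### Flats of points of a polyhedron -/

section Polyhedra

variable {E : Type*} [AddCommGroup E] [Module ℝ E] {ι : Type*} [Finite ι]

/-- From the point `y / 2` of the polyhedron `{x | ∀ i, a i x ≤ b i}`, where `b ≥ 0`, one can move a
little in every direction `v` that is admissible for the constraints tight at all positive multiples
of `y`, namely those with `a i y = b i = 0`. -/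
theorem exists_half_add_smul_mem (a : ι → Dual ℝ E) (b : ι → ℝ) (hb : ∀ i, 0 ≤ b i) (y v : E)
    (hy : ∀ i, a i y ≤ b i) (hv : ∀ i, a i y = 0 → b i = 0 → a i v ≤ 0) :
    ∃ ε : ℝ, 0 < ε ∧ (∀ i, a i ((1 / 2 : ℝ) • y + ε • v) ≤ b i) ∧
      ∀ i, a i y ≠ 0 → a i ((1 / 2 : ℝ) • y + ε • v) ≠ 0 := by
  have hlim : ∀ i, Filter.Tendsto (fun ε : ℝ => a i ((1 / 2 : ℝ) • y + ε • v))
      (nhdsWithin 0 (Set.Ioi 0)) (nhds (a i y / 2)) := fun i => by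
    refine tendsto_nhdsWithin_of_tendsto_nhds ?_
    have : Continuous fun ε : ℝ => a i y / 2 + ε * a i v := by fun_prop
    convert this.tendsto 0 using 2
    · simp; ring
    · simp
  have h1 : ∀ᶠ ε : ℝ in nhdsWithin 0 (Set.Ioi 0), ∀ i, a i ((1 / 2 : ℝ) • y + ε • v) ≤ b i := by
    refine Filter.eventually_all.2 fun i => ?_
    rcases lt_or_ge (a i y / 2) (b i) with h | h
    · exact ((hlim i).eventually_lt_const h).mono fun _ h => h.le
    · filter_upwards [self_mem_nhdsWithin] with ε hε
      have hyi : a i y = 0 := by linarith [hy i, hb i]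
      have hbi : b i = 0 := by linarith [hy i, hb i]
      simp only [map_add, map_smul, hyi, hbi, smul_eq_mul, mul_zero, zero_add]
      exact mul_nonpos_of_nonneg_of_nonpos (le_of_lt hε) (hv i hyi hbi)
  have h2 : ∀ᶠ ε : ℝ in nhdsWithin 0 (Set.Ioi 0), ∀ i, a i y ≠ 0 →
      a i ((1 / 2 : ℝ) • y + ε • v) ≠ 0 := by
    refine Filter.eventually_all.2 fun i => ?_
    by_cases h : a i y = 0
    · simp [h]
    · exact ((hlim i).eventually_ne (by simpa using h)).mono fun _ h _ => h
  obtain ⟨ε, h3, h4, h5⟩ := ((h1.and h2).and self_mem_nhdsWithin).exists.imp fun _ h =>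
    And.intro h.2 h.1
  exact ⟨ε, h3, h4, h5⟩

theorem span_inter_zeroFlat (a : ι → Dual ℝ E) (b : ι → ℝ) (hb : ∀ i, 0 ≤ b i) (y : E)
    (hy : ∀ i, a i y ≤ b i) :
    Submodule.span ℝ ({x | ∀ i, a i x ≤ b i} ∩ zeroFlat a y) = zeroFlat a y := by
  refine le_antisymm (Submodule.span_le.2 Set.inter_subset_right) fun v hv => ?_
  obtain ⟨ε, hε, h, -⟩ := exists_half_add_smul_mem a b hb y v hy fun i hi _ => (hv i hi).le
  have hyy := self_mem_zeroFlat a y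
  have h1 : y ∈ Submodule.span ℝ ({x | ∀ i, a i x ≤ b i} ∩ (zeroFlat a y : Set E)) :=
    Submodule.subset_span ⟨hy, hyy⟩
  have h2 : (1 / 2 : ℝ) • y + ε • v ∈
      Submodule.span ℝ ({x | ∀ i, a i x ≤ b i} ∩ (zeroFlat a y : Set E)) :=
    Submodule.subset_span ⟨h, add_mem (Submodule.smul_mem _ _ hyy) (Submodule.smul_mem _ _ hv)⟩
  have h3 := (Submodule.add_mem_iff_right _ (Submodule.smul_mem _ (1 / 2 : ℝ) h1)).1 h2
  exact (Submodule.smul_mem_iff _ hε.ne').1 h3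

variable [FiniteDimensional ℝ E]

/-- Flats of points of a polyhedron with `b ≥ 0` can be enlarged by one dimension at a time: the
second point is obtained from `y / 2` by a small step along an extreme ray, modulo `zeroFlat a y`,
of the cone of admissible directions. -/
theorem exists_finrank_zeroFlat_eq_succ (a : ι → Dual ℝ E) (b : ι → ℝ) (hb : ∀ i, 0 ≤ b i) (y : E)
    (hy : ∀ i, a i y ≤ b i)
    (hlt : finrank ℝ (zeroFlat a y) < finrank ℝ (Submodule.span ℝ {x | ∀ i, a i x ≤ b i})) :
    ∃ z, (∀ i, a i z ≤ b i) ∧ zeroFlat a y ≤ zeroFlat a z ∧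
      finrank ℝ (zeroFlat a z) = finrank ℝ (zeroFlat a y) + 1 := by
  classical
  have := Fintype.ofFinite ι
  obtain ⟨w, hw, hwy⟩ : ∃ w, (∀ i, a i w ≤ b i) ∧ w ∉ zeroFlat a y := by
    by_contra! h
    exact hlt.not_ge (Submodule.finrank_mono (Submodule.span_le.2 h))
  -- The sign is `-1` where `a i w = 0`, so that such a constraint stays satisfied if `b i = 0`.
  set f : {i // a i y = 0} → Dual ℝ E := fun i => (if a i w ≤ 0 then -1 else 1 : ℝ) • a i with hf
  have hfw : ∀ i, 0 ≤ f i w := fun i => by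
    simp only [hf, LinearMap.smul_apply, smul_eq_mul]
    split_ifs <;> linarith
  have hfz : ∀ i v, f i v = 0 ↔ a i v = 0 := fun i v => by
    simp only [hf, LinearMap.smul_apply, smul_eq_mul]
    split_ifs <;> simp
  have hcw : 0 < (∑ i, f i) w := by
    rw [LinearMap.sum_apply]
    refine (Finset.sum_nonneg fun i _ => hfw i).lt_of_ne fun h => hwy fun i hi => ?_
    rw [eq_comm, Finset.sum_eq_zero_iff_of_nonneg fun i _ => hfw i] at h
    exact (hfz ⟨i, hi⟩ w).1 (h ⟨i, hi⟩ (Finset.mem_univ _))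
  obtain ⟨v, hv, hcv, hvu⟩ := exists_extreme_ray f (∑ i, f i) w hfw hcw
  obtain ⟨ε, hε, hP, hne⟩ := exists_half_add_smul_mem a b hb y v hy fun i hi hbi => by
    have h1 := hv ⟨i, hi⟩
    have h2 : a i w ≤ 0 := hbi ▸ hw i
    simpa [hf, h2] using h1
  have hz0 : ∀ i, a i ((1 / 2 : ℝ) • y + ε • v) = 0 ↔ a i y = 0 ∧ a i v = 0 := fun i => by
    refine ⟨fun h => ?_, fun h => by simp [h.1, h.2]⟩
    have hy0 : a i y = 0 := by_contra fun h' => hne i h' h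
    refine ⟨hy0, ?_⟩
    simpa [hy0, hε.ne'] using h
  have hle : zeroFlat a y ≤ zeroFlat a ((1 / 2 : ℝ) • y + ε • v) :=
    zeroFlat_mono fun i hi => ((hz0 i).1 hi).1
  have hvz : v ∈ zeroFlat a ((1 / 2 : ℝ) • y + ε • v) := fun i hi => ((hz0 i).1 hi).2
  have hvy : v ∉ zeroFlat a y := fun h => by
    rw [LinearMap.sum_apply, Finset.sum_eq_zero fun i _ => (hfz i v).2 (h i i.2)] at hcv
    exact hcv.false
  refine ⟨_, hP, hle, ?_⟩
  have heq : zeroFlat a ((1 / 2 : ℝ) • y + ε • v) = zeroFlat a y ⊔ Submodule.span ℝ {v} := by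
    refine le_antisymm (fun u hu => ?_)
      (sup_le hle ((Submodule.span_singleton_le_iff_mem _ _).2 hvz))
    obtain ⟨t, ht⟩ := hvu u fun i hi => (hfz i u).2 (hu i ((hz0 i).2 ⟨i.2, (hfz i v).1 hi⟩))
    refine Submodule.mem_sup.2 ⟨u - t • v, fun i hi => ?_, t • v,
      Submodule.smul_mem _ _ (Submodule.mem_span_singleton_self v), sub_add_cancel _ _⟩
    refine (hfz ⟨i, hi⟩ _).1 ?_
    simp [ht]
  have hv0 : v ≠ 0 := fun h => hvy (h ▸ zero_mem _)
  have hdisj : Disjoint (zeroFlat a y) (Submodule.span ℝ {v}) :=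
    (Submodule.disjoint_span_singleton' hv0).2 hvy
  rw [heq, ← finrank_span_singleton (K := ℝ) hv0]
  have := Submodule.finrank_sup_add_finrank_inf_eq (zeroFlat a y) (Submodule.span ℝ {v})
  rwa [hdisj.eq_bot, finrank_bot, add_zero] at this

theorem exists_finrank_zeroFlat_eq (a : ι → Dual ℝ E) (b : ι → ℝ) (hb : ∀ i, 0 ≤ b i) (y : E)
    (hy : ∀ i, a i y ≤ b i) (e : ℕ) (hye : finrank ℝ (zeroFlat a y) ≤ e)
    (he : e ≤ finrank ℝ (Submodule.span ℝ {x | ∀ i, a i x ≤ b i})) :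
    ∃ z, (∀ i, a i z ≤ b i) ∧ zeroFlat a y ≤ zeroFlat a z ∧ finrank ℝ (zeroFlat a z) = e := by
  induction e, hye using Nat.le_induction with
  | base => exact ⟨y, hy, le_rfl, rfl⟩
  | succ e hye ih =>
    obtain ⟨z, hz, hyz, rfl⟩ := ih (by omega)
    obtain ⟨z', hz', hzz', h⟩ := exists_finrank_zeroFlat_eq_succ a b hb z hz (by omega)
    exact ⟨z', hz', hyz.trans hzz', h⟩

end Polyhedra

/-! ### Compactness of polyhedra -/

section Compactness

variable {E : Type*} [NormedAddCommGroup E] [NormedSpace ℝ E] [FiniteDimensional ℝ E]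

/-- A polyhedron `{x | ∀ i, a i x ≤ b i}` with `b ≥ 0` and trivial recession cone is compact. -/
theorem isCompact_of_recession_trivial {ι : Type*} [Fintype ι] (a : ι → Dual ℝ E) (b : ι → ℝ)
    (hb : ∀ i, 0 ≤ b i) (hrec : ∀ v, (∀ i, a i v ≤ 0) → v = 0) :
    IsCompact {x | ∀ i, a i x ≤ b i} := by
  have hcont : ∀ i, Continuous (a i) := fun i => LinearMap.continuous_of_finiteDimensional _
  have hclosed : IsClosed {x | ∀ i, a i x ≤ b i} := by
    simp only [Set.ofPred_forall]
    exact isClosed_iInter fun i => isClosed_le (hcont i) continuous_const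
  have := FiniteDimensional.proper_real E
  refine Metric.isCompact_of_isClosed_isBounded hclosed ?_
  rcases subsingleton_or_nontrivial E with hE | hE
  · exact (Set.toFinite _).isBounded
  -- The positively homogeneous function `φ` is positive on the unit sphere, by compactness at least
  -- `φ v > 0`, and at most `∑ i, b i` on the polyhedron.
  set φ : E → ℝ := fun x => ∑ i, max (a i x) 0 with hφ
  have hφc : Continuous φ := continuous_finsetSum _ fun i _ => (hcont i).max continuous_const
  obtain ⟨v, hv, hmin⟩ := (isCompact_sphere (0 : E) 1).exists_isMinOn
    ((NormedSpace.sphere_nonempty).2 zero_le_one) hφc.continuousOn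
  have hnn : ∀ x, ∀ i ∈ Finset.univ, 0 ≤ max (a i x) 0 := fun x i _ => le_max_right _ _
  have hpos : 0 < φ v := by
    refine (Finset.sum_nonneg (hnn v)).lt_of_ne fun h => ?_
    rw [eq_comm, Finset.sum_eq_zero_iff_of_nonneg (hnn v)] at h
    have hv0 := hrec v fun i => max_eq_right_iff.1 (h i (Finset.mem_univ i))
    simp [hv0] at hv
  refine isBounded_iff_forall_norm_le.2 ⟨(∑ i, b i) / φ v, fun x hx => ?_⟩
  have hφx : φ x ≤ ∑ i, b i := Finset.sum_le_sum fun i _ => max_le (hx i) (hb i)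
  rw [le_div_iff₀ hpos]
  rcases eq_or_ne x 0 with rfl | hx0
  · simpa using Finset.sum_nonneg fun i _ => hb i
  have hn : 0 < ‖x‖ := norm_pos_iff.2 hx0
  have hmem : ‖x‖⁻¹ • x ∈ Metric.sphere (0 : E) 1 := by
    simp [norm_smul, hn.ne']
  have h1 : φ v ≤ φ (‖x‖⁻¹ • x) := hmin hmem
  have h2 : ‖x‖ * φ (‖x‖⁻¹ • x) = φ x := by
    simp only [hφ, Finset.mul_sum, map_smul, smul_eq_mul]
    refine Finset.sum_congr rfl fun i _ => ?_
    rw [mul_max_of_nonneg _ _ hn.le, mul_zero, mul_inv_cancel_left₀ hn.ne']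
  calc ‖x‖ * φ v ≤ ‖x‖ * φ (‖x‖⁻¹ • x) := by gcongr
    _ ≤ ∑ i, b i := h2 ▸ hφx

end Compactness

/-! ### Integer forms and the recession cone -/

section IntegerForms

variable {m n : ℕ}

/-- The linear form on `ℝⁿ` with the integer coefficient vector `w`; the rows of `A` are the forms
`intForm (A i)`. -/
noncomputable def intForm (w : Fin n → ℤ) : Dual ℝ (Fin n → ℝ) :=
  dotProductBilin ℝ ℝ fun j => (w j : ℝ)

theorem intForm_apply (w : Fin n → ℤ) (x : Fin n → ℝ) :
    intForm w x = (fun j => (w j : ℝ)) ⬝ᵥ x := rfl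

theorem intForm_intCast (w z : Fin n → ℤ) :
    intForm w (fun j => (z j : ℝ)) = ((w ⬝ᵥ z : ℤ) : ℝ) := by
  simp [intForm_apply, dotProduct]

theorem mem_kerRows {A : Matrix (Fin m) (Fin n) ℤ} {I : Finset (Fin m)} {x : Fin n → ℝ} :
    x ∈ kerRows A I ↔ ∀ i ∈ I, intForm (A i) x = 0 := by
  rw [kerRows, LinearMap.mem_ker, Matrix.mulVecLin_apply, funext_iff, Subtype.forall]
  rfl

theorem indepRows_iff {A : Matrix (Fin m) (Fin n) ℤ} {I : Finset (Fin m)} :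
    IndepRows A I ↔ LinearIndepOn ℝ (fun i j => (A i j : ℝ)) (I : Set (Fin m)) := Iff.rfl

theorem IndepRows.rank_eq {A : Matrix (Fin m) (Fin n) ℤ} {I : Finset (Fin m)}
    (h : IndepRows A I) : (rowsOf A I).rank = I.card := by
  rw [LinearIndependent.rank_matrix h, Fintype.card_coe]

theorem IndepRows.card_add_finrank_kerRows {A : Matrix (Fin m) (Fin n) ℤ} {I : Finset (Fin m)}
    (h : IndepRows A I) : I.card + finrank ℝ (kerRows A I) = n := by
  rw [← h.rank_eq, Matrix.rank, kerRows, LinearMap.finrank_range_add_finrank_ker]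
  simp

/-- An integer matrix with a nontrivial real kernel has a nontrivial integer kernel: the determinant
of its Gram matrix vanishes. -/
theorem exists_int_mulVec_eq_zero {κ : Type*} [Fintype κ] (B : Matrix κ (Fin n) ℤ)
    (v : Fin n → ℝ) (hv : v ≠ 0) (h : ∀ k, intForm (B k) v = 0) :
    ∃ z : Fin n → ℤ, z ≠ 0 ∧ ∀ k, B k ⬝ᵥ z = 0 := by
  have hB : B.map (Int.cast : ℤ → ℝ) *ᵥ v = 0 := funext h
  have hdet : (Bᵀ * B).det = 0 := by
    have h1 : ((Bᵀ * B).map (Int.castRingHom ℝ)).det = 0 := by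
      refine Matrix.exists_mulVec_eq_zero_iff.1 ⟨v, hv, ?_⟩
      rw [Matrix.map_mul, ← Matrix.mulVec_mulVec]
      exact (congrArg _ hB).trans (Matrix.mulVec_zero _)
    have h2 := RingHom.map_det (Int.castRingHom ℝ) (Bᵀ * B)
    rw [RingHom.mapMatrix_apply, h1] at h2
    simpa using h2
  obtain ⟨z, hz, hBz⟩ := Matrix.exists_mulVec_eq_zero_iff.2 hdet
  refine ⟨z, hz, fun k => ?_⟩
  have h3 : (B *ᵥ z) ⬝ᵥ (B *ᵥ z) = 0 := by
    rw [Matrix.dotProduct_mulVec, Matrix.vecMul_mulVec, ← Matrix.dotProduct_mulVec, hBz,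
      dotProduct_zero]
  exact congrFun (dotProduct_self_eq_zero.1 h3) k

/-- If `0` is the only integer point of a rational polyhedron, then its recession cone is trivial:
otherwise the cone contains a line or has an extreme ray, either of which gives rise to an integer
point other than `0`. -/
theorem recession_trivial {A : Matrix (Fin m) (Fin n) ℤ} {b : Fin m → ℤ}
    (hzero : {z : Fin n → ℤ | (fun j => (z j : ℝ)) ∈ poly A b} = {0}) (hb : ∀ i, 0 ≤ b i)
    (v : Fin n → ℝ) (hv : ∀ i, intForm (A i) v ≤ 0) : v = 0 := by
  have hint : ∀ z : Fin n → ℤ, (∀ i, A i ⬝ᵥ z ≤ 0) → z = 0 := fun z hz => by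
    have : z ∈ {z : Fin n → ℤ | (fun j => (z j : ℝ)) ∈ poly A b} := fun i => by
      rw [← intForm_apply, intForm_intCast]
      exact_mod_cast (hz i).trans (hb i)
    rwa [hzero] at this
  have hinj : ∀ v : Fin n → ℝ, (∀ i, intForm (A i) v = 0) → v = 0 := fun v hv => by
    by_contra hne
    obtain ⟨z, hz, hz'⟩ := exists_int_mulVec_eq_zero A v hne hv
    exact hz (hint z fun i => (hz' i).le)
  by_contra hne
  have hnn : ∀ i, 0 ≤ (-intForm (A i)) v := fun i => by simpa using hv i
  have hc : 0 < (∑ i, -intForm (A i)) v := by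
    rw [LinearMap.sum_apply]
    refine (Finset.sum_nonneg fun i _ => hnn i).lt_of_ne fun h => hne (hinj v fun i => ?_)
    rw [eq_comm, Finset.sum_eq_zero_iff_of_nonneg fun i _ => hnn i] at h
    simpa using h i (Finset.mem_univ i)
  obtain ⟨w, hw, hcw, hray⟩ := exists_extreme_ray (fun i => -intForm (A i)) _ v hnn hc
  have hw0 : w ≠ 0 := fun h => by simp [h] at hcw
  -- The ray through `w` is cut out by integer equations, so it contains an integer vector.
  obtain ⟨z, hz, hz'⟩ := exists_int_mulVec_eq_zero
    (A.submatrix (Subtype.val : {i // intForm (A i) w = 0} → Fin m) id) w hw0 fun i => i.2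
  obtain ⟨t, ht⟩ := hray (fun j => (z j : ℝ)) fun i hi => by
    have := hz' ⟨i, by simpa using hi⟩
    rw [LinearMap.neg_apply, intForm_intCast, neg_eq_zero, Int.cast_eq_zero]
    exact this
  have ht' : ∀ i, ((A i ⬝ᵥ z : ℤ) : ℝ) = t * intForm (A i) w := fun i => by
    have := ht i
    rw [LinearMap.neg_apply, LinearMap.neg_apply, intForm_intCast] at this
    linarith
  have hw' : ∀ i, intForm (A i) w ≤ 0 := fun i => by simpa using hw i
  rcases le_total 0 t with h | h
  · refine hz (hint z fun i => ?_)
    have := mul_nonpos_of_nonneg_of_nonpos h (hw' i)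
    rw [← ht'] at this
    exact_mod_cast this
  · refine hz (neg_eq_zero.1 (hint (-z) fun i => ?_))
    have := mul_nonneg_of_nonpos_of_nonpos h (hw' i)
    rw [← ht'] at this
    rw [dotProduct_neg, neg_nonpos]
    exact_mod_cast this

/-- Independent rows vanishing at `y` extend to an independent set of rows that defines the flat of
`y`. -/
theorem exists_indepRows_kerRows_eq {A : Matrix (Fin m) (Fin n) ℤ} {I : Finset (Fin m)}
    (hI : IndepRows A I) (y : Fin n → ℝ) (hy : y ∈ kerRows A I) :
    ∃ J, I ⊆ J ∧ IndepRows A J ∧ kerRows A J = zeroFlat (fun i => intForm (A i)) y := by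
  classical
  obtain ⟨B, hBt, hIB, hspan, hB⟩ := exists_linearIndepOn_extension (indepRows_iff.1 hI)
    (t := {i | intForm (A i) y = 0}) fun i hi => mem_kerRows.1 hy i hi
  refine ⟨B.toFinset, fun i hi => by simpa using hIB hi, ?_, le_antisymm (fun v hv i hi => ?_)
    fun v hv => mem_kerRows.2 fun i hi => hv i (hBt (by simpa using hi))⟩
  · rw [indepRows_iff, Set.coe_toFinset]
    exact hB
  · have h : Submodule.span ℝ ((fun i j => (A i j : ℝ)) '' B) ≤
        LinearMap.ker ((dotProductBilin ℝ ℝ).flip v : Dual ℝ (Fin n → ℝ)) := by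
      refine Submodule.span_le.2 ?_
      rintro _ ⟨k, hk, rfl⟩
      exact mem_kerRows.1 hv k (by simpa using hk)
    exact h (hspan ⟨i, hi, rfl⟩)

end IntegerForms

/-! ### Greatest common divisors of minors -/

section Minors

variable {m n : ℕ}

theorem det_intCast_ne_zero_iff {r : ℕ} (M : Matrix (Fin r) (Fin r) ℤ) :
    (M.map (Int.cast : ℤ → ℝ)).det ≠ 0 ↔ M.det ≠ 0 := by
  have h := RingHom.map_det (Int.castRingHom ℝ) M
  rw [RingHom.mapMatrix_apply] at h
  rw [show M.map (Int.cast : ℤ → ℝ) = M.map (Int.castRingHom ℝ) from rfl, ← h]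
  simp

theorem gcdRows_ne_zero {A : Matrix (Fin m) (Fin n) ℤ} {I : Finset (Fin m)}
    (hI : IndepRows A I) : gcdRows A I ≠ 0 := by
  classical
  obtain ⟨κ, c, hc, hspan, hli⟩ := exists_linearIndependent' ℝ (rowsOf A I).col
  have := Finite.of_injective c hc
  have := Fintype.ofFinite κ
  have hcard : Fintype.card κ = (rowsOf A I).rank := by
    rw [Matrix.rank_eq_finrank_span_cols, ← hspan, finrank_span_eq_card hli]
  let e : Fin (rowsOf A I).rank ≃ κ := (Fintype.equivFinOfCardEq hcard).symm
  let f : Fin (rowsOf A I).rank ≃ I :=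
    (Fintype.equivFinOfCardEq (by rw [hI.rank_eq, Fintype.card_coe])).symm
  intro h
  have h0 := Finset.gcd_eq_zero_iff.1 h
    (f.toEmbedding, ⟨c ∘ e, hc.comp e.injective⟩) (Finset.mem_univ _)
  refine (det_intCast_ne_zero_iff _).1 ?_ (Int.natAbs_eq_zero.1 h0)
  rw [← isUnit_iff_ne_zero, ← Matrix.isUnit_iff_isUnit_det,
    ← Matrix.linearIndependent_cols_iff_isUnit]
  exact (hli.comp e e.injective).map' (LinearEquiv.funCongrLeft ℝ ℝ f).toLinearMap
    (LinearEquiv.ker _)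

theorem gcdRows_dvd_minor {A : Matrix (Fin m) (Fin n) ℤ} {I : Finset (Fin m)}
    (hI : IndepRows A I) {r : ℕ} (f : Fin r → Fin m) (hf : f.Injective) (hfI : Set.range f = I)
    (c : Fin r → Fin n) : (gcdRows A I : ℤ) ∣ (A.submatrix f c).det := by
  obtain rfl : r = (rowsOf A I).rank := by
    rw [hI.rank_eq, ← Set.ncard_coe_finset I, ← hfI, Set.ncard_range_of_injective hf]
    simp
  by_cases hc : c.Injective
  · rw [Int.natCast_dvd]
    exact Finset.gcd_dvd (b := ((⟨fun i => ⟨f i, Finset.mem_coe.1 (hfI ▸ Set.mem_range_self i)⟩,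
      fun i j h => hf (congrArg Subtype.val h)⟩ : Fin (rowsOf A I).rank ↪ I),
      (⟨c, hc⟩ : Fin (rowsOf A I).rank ↪ Fin n))) (Finset.mem_univ _)
  · obtain ⟨i, j, hij, hne⟩ := Function.not_injective_iff.1 hc
    rw [Matrix.det_zero_of_column_eq hne fun k => by simp [hij]]
    exact dvd_zero _

/-- A common divisor of all maximal minors of the rows in `I` also divides those of `insert j I`, by
expansion along the row `j`. -/
theorem dvd_minor_insert {A : Matrix (Fin m) (Fin n) ℤ} {I : Finset (Fin m)} {g : ℤ}
    (hg : ∀ (r : ℕ) (f : Fin r → Fin m), f.Injective → Set.range f = I →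
      ∀ c : Fin r → Fin n, g ∣ (A.submatrix f c).det) {j : Fin m} (hj : j ∉ I)
    (r : ℕ) (f : Fin r → Fin m) (hf : f.Injective) (hfI : Set.range f = insert j (I : Set (Fin m)))
    (c : Fin r → Fin n) : g ∣ (A.submatrix f c).det := by
  obtain ⟨s, hs⟩ : j ∈ Set.range f := hfI ▸ Set.mem_insert _ _
  obtain _ | r := r
  · exact s.elim0
  rw [Matrix.det_succ_row _ s]
  refine Finset.dvd_sum fun t _ => Dvd.dvd.mul_left ?_ _
  rw [Matrix.submatrix_submatrix]
  refine hg r _ (hf.comp Fin.succAbove_right_injective) ?_ _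
  rw [Set.range_comp, Fin.range_succAbove, Set.image_compl_eq_range_sdiff_image hf, hfI,
    Set.image_singleton, hs]
  exact Set.insert_sdiff_self_of_notMem hj

theorem gcdRows_dvd_gcdRows {A : Matrix (Fin m) (Fin n) ℤ} {I J : Finset (Fin m)}
    (hI : IndepRows A I) (hJ : IndepRows A J) (hIJ : I ⊆ J) : gcdRows A I ∣ gcdRows A J := by
  classical
  have key : ∀ S : Finset (Fin m), ∀ (r : ℕ) (f : Fin r → Fin m), f.Injective →
      Set.range f = (I ∪ S : Finset (Fin m)) →
      ∀ c : Fin r → Fin n, (gcdRows A I : ℤ) ∣ (A.submatrix f c).det := by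
    intro S
    induction S using Finset.induction_on with
    | empty => intro r f hf hfI; rw [Finset.union_empty] at hfI; exact gcdRows_dvd_minor hI f hf hfI
    | insert j S _ ih =>
      rw [Finset.union_insert]
      by_cases hj : j ∈ I ∪ S
      · rwa [Finset.insert_eq_of_mem hj]
      · rw [Finset.coe_insert]
        exact dvd_minor_insert ih hj
  refine Finset.dvd_gcd fun p _ => Int.natCast_dvd.1 (key J _ _
    (Subtype.val_injective.comp p.1.injective) ?_ _)
  have hp : Function.Bijective p.1 := (Fintype.bijective_iff_injective_and_card _).2
    ⟨p.1.injective, by rw [Fintype.card_fin, Fintype.card_coe, hJ.rank_eq]⟩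
  rw [Finset.union_eq_right.2 hIJ, Set.range_comp, hp.surjective.range_eq]
  simp

end Minors

/-! ### Monotonicity and positivity of `Δ` -/

section Delta

variable {m n : ℕ} {A : Matrix (Fin m) (Fin (n + 1)) ℤ} {α : Fin (n + 1) → ℤ}

theorem Delta_nonneg (I : Finset (Fin m)) : 0 ≤ Delta A α I := by
  unfold Delta
  positivity

theorem Delta_anti {I J : Finset (Fin m)} (hI : IndepRows A I) (hJ : IndepRows A J) (hIJ : I ⊆ J) :
    Delta A α J ≤ Delta A α I := by
  have h1 : maxDet A α J ≤ maxDet A α I := Finset.sup_mono fun f hf => by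
    simp only [Finset.mem_filter, Finset.mem_univ, true_and] at hf ⊢
    exact fun i hi => hf i (hIJ hi)
  have h2 : gcdRows A I ≤ gcdRows A J :=
    Nat.le_of_dvd (Nat.pos_of_ne_zero (gcdRows_ne_zero hJ)) (gcdRows_dvd_gcdRows hI hJ hIJ)
  have h3 : 0 < gcdRows A I := Nat.pos_of_ne_zero (gcdRows_ne_zero hI)
  unfold Delta
  gcongr

/-- If `α` is not a combination of the independent rows in `J`, then `α` and these rows can be
completed to a basis by further rows of `A`. -/
theorem maxDet_ne_zero (hinj : ∀ v, (∀ i, intForm (A i) v = 0) → v = 0) {J : Finset (Fin m)}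
    (hJ : IndepRows A J)
    (hα : (fun j => (α j : ℝ)) ∉ Submodule.span ℝ ((fun i j => (A i j : ℝ)) '' (J : Set (Fin m)))) :
    maxDet A α J ≠ 0 := by
  classical
  let u : Option (Fin m) → Fin (n + 1) → ℝ := fun o => o.elim (fun j => (α j : ℝ)) fun i j => A i j
  have hu : LinearIndepOn ℝ u (insert none (some '' (J : Set (Fin m)))) := by
    refine LinearIndepOn.insert ?_ (by rwa [Set.image_image])
    exact LinearIndepOn.image_of_comp some u hJ
  obtain ⟨B, -, hB, hspan, hli⟩ := exists_linearIndepOn_extension hu (Set.subset_univ _)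
  have hrows : Submodule.span ℝ (Set.range (A.map (Int.cast : ℤ → ℝ)).row) = ⊤ := by
    refine Submodule.eq_top_of_finrank_eq ?_
    rw [← Matrix.rank_eq_finrank_span_row, Matrix.rank]
    refine LinearMap.finrank_range_of_inj ?_
    rw [← LinearMap.ker_eq_bot, Submodule.eq_bot_iff]
    exact fun v hv => hinj v fun i => congrFun (LinearMap.mem_ker.1 hv) i
  have htop : Submodule.span ℝ (Set.range fun o : B => u o) = ⊤ := by
    rw [eq_top_iff, ← hrows, Submodule.span_le]
    rintro _ ⟨i, rfl⟩
    rw [← Set.image_eq_range]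
    exact hspan ⟨some i, trivial, rfl⟩
  have hcard : Fintype.card B = n + 1 := by
    rw [← finrank_span_eq_card hli, htop, finrank_top, finrank_fin_fun]
  let e₀ : Fin (n + 1) ≃ B := (Fintype.equivFinOfCardEq hcard).symm
  let e : Fin (n + 1) ≃ B := (Equiv.swap 0 (e₀.symm ⟨none, hB (Set.mem_insert _ _)⟩)).trans e₀
  have he0 : (e 0 : Option (Fin m)) = none := by simp [e]
  have hes : ∀ k : Fin n, ∃ i, (e k.succ : Option (Fin m)) = some i := fun k => by
    refine Option.ne_none_iff_exists'.1 fun h => Fin.succ_ne_zero k (e.injective ?_)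
    exact Subtype.ext (h.trans he0.symm)
  choose f hf using hes
  have hfinj : f.Injective := fun k l h => by
    refine Fin.succ_injective _ (e.injective (Subtype.ext ?_))
    rw [hf, hf, h]
  have hfJ : ∀ i ∈ J, i ∈ Set.range f := fun i hi => by
    have hiB : some i ∈ B := hB (Set.mem_insert_of_mem _ ⟨i, hi, rfl⟩)
    obtain ⟨k, hk⟩ := e.surjective ⟨some i, hiB⟩
    obtain rfl | ⟨l, rfl⟩ := k.eq_zero_or_eq_succ
    · simp [hk] at he0
    · exact ⟨l, Option.some_injective _ (by rw [← hf, hk])⟩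
  have hdet : (Matrix.of (Matrix.vecCons α fun j => A (f j))).det ≠ 0 := by
    rw [← det_intCast_ne_zero_iff, ← isUnit_iff_ne_zero, ← Matrix.isUnit_iff_isUnit_det,
      ← Matrix.linearIndependent_rows_iff_isUnit]
    have hrow : ((Matrix.of (Matrix.vecCons α fun j => A (f j))).map (Int.cast : ℤ → ℝ)).row =
        fun k => u (e k) := by
      funext k j
      refine Fin.cases ?_ (fun l => ?_) k
      · simp [he0, u]
      · simp [hf, u]
    rw [hrow]
    exact hli.comp e e.injective
  have hle : (Matrix.of (Matrix.vecCons α fun j => A (f j))).det.natAbs ≤ maxDet A α J :=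
    Finset.le_sup (f := fun f : Fin n ↪ Fin m =>
      (Matrix.of (Matrix.vecCons α fun j => A (f j))).det.natAbs) (b := ⟨f, hfinj⟩)
      (Finset.mem_filter.2 ⟨Finset.mem_univ _, hfJ⟩)
  have := Int.natAbs_pos.2 hdet
  omega

theorem linForm_eq_zero_of_Delta_eq_zero (hinj : ∀ v, (∀ i, intForm (A i) v = 0) → v = 0)
    {J : Finset (Fin m)} (hJ : IndepRows A J) (hΔ : Delta A α J = 0) {x : Fin (n + 1) → ℝ}
    (hx : x ∈ kerRows A J) : linForm α x = 0 := by
  by_cases hα : (fun j => (α j : ℝ)) ∈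
      Submodule.span ℝ ((fun i j => (A i j : ℝ)) '' (J : Set (Fin m)))
  · have h : Submodule.span ℝ ((fun i j => (A i j : ℝ)) '' (J : Set (Fin m))) ≤
        LinearMap.ker ((dotProductBilin ℝ ℝ).flip x : Dual ℝ (Fin (n + 1) → ℝ)) := by
      refine Submodule.span_le.2 ?_
      rintro _ ⟨k, hk, rfl⟩
      exact mem_kerRows.1 hx k hk
    exact h hα
  · have h1 := maxDet_ne_zero hinj hJ hα
    have h2 := gcdRows_ne_zero hJ
    simp [Delta, h1, h2] at hΔ

end Delta

/-! ### The bound on a slice -/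

section Kappa

variable {m n : ℕ} {A : Matrix (Fin m) (Fin (n + 1)) ℤ} {b : Fin m → ℤ} {α : Fin (n + 1) → ℤ}

theorem dim_eq_finrank_span {S : Set (Fin n → ℝ)} (h : (0 : Fin n → ℝ) ∈ S) :
    dim S = finrank ℝ (Submodule.span ℝ S) := by
  have hS : (fun x => x -ᵥ (0 : Fin n → ℝ)) '' S = S :=
    (Set.image_congr fun x _ => sub_zero x).trans (Set.image_id' S)
  rw [dim, vectorSpan_eq_span_vsub_set_right ℝ h, hS]

/-- On a slice `P_J` with `I ⊆ J` the form `α` is bounded in terms of `Δ_I` and the dimension of the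
slice. -/
theorem linForm_le_Delta_mul_kappa (hinj : ∀ v, (∀ i, intForm (A i) v = 0) → v = 0)
    (hP : IsCompact (poly A b)) (h0 : 0 ∈ poly A b) {I J : Finset (Fin m)} (hI : IndepRows A I)
    (hJ : IndepRows A J) (hIJ : I ⊆ J) (hcard : J.card ≤ n) {y : Fin (n + 1) → ℝ}
    (hy : y ∈ polySlice A b J) :
    linForm α y ≤ Delta A α I * kappa A b α (dim (polySlice A b J)) := by
  have hbdd : BddAbove (linForm α '' polySlice A b J) :=
    (hP.bddAbove_image (intForm α).continuous_of_finiteDimensional.continuousOn).mono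
      (Set.image_mono Set.inter_subset_left)
  have hs0 : 0 ≤ sSup (linForm α '' polySlice A b J) :=
    le_csSup hbdd ⟨0, ⟨h0, zero_mem _⟩, map_zero (intForm α)⟩
  have hk : kappaSet A b α J ≤ kappa A b α (dim (polySlice A b J)) :=
    le_csSup (Set.toFinite _).bddAbove ⟨J, ⟨hcard, hJ, rfl⟩, rfl⟩
  have hk0 : 0 ≤ kappaSet A b α J := div_nonneg hs0 (Delta_nonneg J)
  have hyJ : linForm α y ≤ Delta A α J * kappaSet A b α J := by
    rcases eq_or_ne (Delta A α J) 0 with hΔ | hΔ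
    · rw [linForm_eq_zero_of_Delta_eq_zero hinj hJ hΔ hy.2, hΔ, zero_mul]
    · rw [kappaSet, mul_div_cancel₀ _ hΔ]
      exact le_csSup hbdd ⟨y, hy, rfl⟩
  calc linForm α y ≤ Delta A α J * kappaSet A b α J := hyJ
    _ ≤ Delta A α I * kappa A b α (dim (polySlice A b J)) :=
      mul_le_mul (Delta_anti hI hJ hIJ) hk hk0 (Delta_nonneg I)

end Kappa

end Proximity

/-! ### Proof of the bound -/

open Proximity
/-- The ambient space is `ℝ^(n+1)`, `n ≥ 0`; dimension zero is void since `dim P ≥ 1`. -/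
theorem theorem5 {m n : ℕ} (A : Matrix (Fin m) (Fin (n + 1)) ℤ) (b : Fin m → ℤ)
    (α : Fin (n + 1) → ℤ)
    (hzero : {z : Fin (n + 1) → ℤ | (fun j => (z j : ℝ)) ∈ poly A b} = {0})
    (I : Finset (Fin m)) (hI : IndepRows A I)
    (hker : kerRows A I = Submodule.span ℝ (poly A b))
    (k : ℕ) (d : Fin (k + 1) → ℕ) (hd : ∀ i, 1 ≤ d i)
    (hdim : dim (poly A b) = ∑ i, d i) :
    ∃ M : ℝ, IsGreatest (linForm α '' poly A b) M ∧
      M ≤ Delta A α I * ∑ i, kappa A b α (d i) := by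
  have h0 : (0 : Fin (n + 1) → ℝ) ∈ poly A b := by
    have h : (0 : Fin (n + 1) → ℤ) ∈ {z : Fin (n + 1) → ℤ | (fun j => (z j : ℝ)) ∈ poly A b} := by
      rw [hzero]; rfl
    have h' : (fun j => (((0 : Fin (n + 1) → ℤ) j : ℤ) : ℝ)) ∈ poly A b := h
    convert h'
    simp
  have hb : ∀ i, 0 ≤ b i := fun i => by
    have := h0 i
    rw [dotProduct_zero] at this
    exact_mod_cast this
  have hb' : ∀ i, (0 : ℝ) ≤ b i := fun i => by exact_mod_cast hb i
  have hrec := recession_trivial hzero hb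
  have hinj : ∀ v, (∀ i, intForm (A i) v = 0) → v = 0 := fun v hv => hrec v fun i => (hv i).le
  have hP : IsCompact (poly A b) :=
    isCompact_of_recession_trivial (fun i => intForm (A i)) (fun i => (b i : ℝ)) hb' hrec
  obtain ⟨x, hx, hmax⟩ := hP.exists_isMaxOn ⟨0, h0⟩
    (intForm α).continuous_of_finiteDimensional.continuousOn
  refine ⟨linForm α x, ⟨⟨x, hx, rfl⟩, ?_⟩, ?_⟩
  · rintro _ ⟨y, hy, rfl⟩
    exact hmax hy
  rw [dim_eq_finrank_span h0] at hdim
  have hkerI : ∀ y ∈ poly A b, y ∈ kerRows A I := fun y hy => hker ▸ Submodule.subset_span hy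
  rw [Finset.mul_sum]
  refine le_sum_of_finrank_zeroFlat_le (fun i => intForm (A i)) hinj (fun i => (b i : ℝ)) hb'
    (intForm α) (fun e => Delta A α I * kappa A b α e) (k + 1) d (fun j y hy hyd => ?_) x hx ?_
  · -- A flat of dimension exactly `d j` that contains `y` and is spanned by a point of `P`.
    obtain ⟨z, hz, hyz, hzd⟩ := exists_finrank_zeroFlat_eq (fun i => intForm (A i))
      (fun i => (b i : ℝ)) hb' y hy (d j) hyd
      ((Finset.single_le_sum (fun _ _ => Nat.zero_le _) (Finset.mem_univ j)).trans hdim.ge)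
    obtain ⟨J, hIJ, hJ, hJz⟩ := exists_indepRows_kerRows_eq hI z (hkerI z hz)
    have hdimJ : dim (polySlice A b J) = d j := by
      have h0J : 0 ∈ polySlice A b J := ⟨h0, zero_mem _⟩
      rw [dim_eq_finrank_span h0J, ← hzd, polySlice, hJz]
      exact congrArg (fun S : Submodule ℝ (Fin (n + 1) → ℝ) => finrank ℝ S)
        (span_inter_zeroFlat (fun i => intForm (A i)) (fun i => (b i : ℝ)) hb' z hz)
    have hcard : J.card ≤ n := by
      have h1 := hJ.card_add_finrank_kerRows
      rw [hJz, hzd] at h1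
      have := hd j
      omega
    rw [← hdimJ]
    have hyJ : y ∈ kerRows A J := hJz ▸ hyz (self_mem_zeroFlat _ y)
    exact linForm_le_Delta_mul_kappa hinj hP h0 hI hJ hIJ hcard ⟨hy, hyJ⟩
  · rw [← hdim, ← hker]
    exact Submodule.finrank_mono fun v hv => mem_kerRows.2 fun i hi =>
      hv i (mem_kerRows.1 (hkerI x hx) i hi)
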